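/- Theorem 1. For \(x\in\{0,1\}\) put \(\overline x=1-x\). Let \(G\) be Grigorchuk's \(2\)-group: the group of permutations of the set \(\{0,1\}^*\) of finite sequences over \(\{0,1\}\) generated by the length-preserving permutations \(a,b,c,d\) that fix the empty sequence and satisfy, for \(x\in\{0,1\}\) and \(\sigma\in\{0,1\}^*\), \[ a(x\sigma)=\overline x\sigma,\qquad b(0\sigma)=0\,a(\sigma),\quad b(1\sigma)=1\,c(\sigma),\qquad c(0\sigma)=0\,a(\sigma),\quad c(1\sigma)=1\,d(\sigma),\qquad d(0\sigma)=0\sigma,\quad d(1\sigma)=1\,b(\sigma). \] Let \(S\) be a finite subset of \(G\) that generates \(G\) as a monoid, and let \(\omega:S\to(0,\infty)\) be any weight function. For \(g\in G\) put \[ \partial_\omega(g)=\min\{\omega(s_1)+\dots+\omega(s_k) : k\ge 0,\ s_1,\dots,s_k\in S,\ s_1\cdots s_k=g\}, \] and for real \(n\ge 0\) let \(\gamma(n)=\#\{g\in G : \partial_\omega(g)\le n\}\) be the growth function of \(G\) with respect to \(\omega\) (for instance, \(S=\{a,b,c,d\}\) and \(\omega\equiv1\) give the usual word growth). Let \(\alpha=0.5157\).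 Then \(\gamma(n)\succsim e^{n^{\alpha}}\); that is, there is a constant \(C>0\) such that \[ e^{n^{\alpha}}\le\gamma(Cn)\qquad\text{for all real } n\ge 1 . \] Moreover, Grigorchuk's lower bound \(e^{\sqrt n}\precsim\gamma(n)\) is not tight: \(\gamma(n)\not\precsim e^{\sqrt n}\); that is, there is no constant \(C>0\) such that \(\gamma(n)\le e^{\sqrt{Cn}}\) for all real \(n\ge 1\). In particular the growth of \(G\) is not equivalent to \(e^{\sqrt n}\). -/

import Mathlib

namespace Grigorchuk

/-- Labels of the four standard generators of Grigorchuk's 2-group. -/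
inductive Gen : Type
  | a
  | b
  | c
  | d

/-- The action of the generators on finite sequences over `{0, 1}`; the letter `0` is `false` and
the letter `1` is `true`. -/
def act : Gen → List Bool → List Bool
  | _, [] => []
  | Gen.a, x :: σ => (!x) :: σ
  | Gen.b, false :: σ => false :: act Gen.a σ
  | Gen.b, true :: σ => true :: act Gen.c σ
  | Gen.c, false :: σ => false :: act Gen.a σ
  | Gen.c, true :: σ => true :: act Gen.d σ
  | Gen.d, false :: σ => false :: σ
  | Gen.d, true :: σ => true :: act Gen.b σ

theorem act_involutive (s : Gen) : Function.Involutive (act s) := by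
  intro w
  induction w generalizing s with
  | nil => cases s <;> simp [act]
  | cons x σ ih => cases s <;> cases x <;> simp [act, ih]

/-- The generators as permutations of the set of finite sequences. -/
def perm (s : Gen) : Equiv.Perm (List Bool) := (act_involutive s).toPerm

/-- Grigorchuk's 2-group: the group of permutations of the set of finite sequences over `{0, 1}`
generated by `a, b, c, d`. -/
def G : Subgroup (Equiv.Perm (List Bool)) := Subgroup.closure (Set.range perm)

end Grigorchuk

section Growth

variable {Γ : Type*} [Group Γ]

/-- The norm on a group induced by a weight `ω` on a finite generating set `S`: the least total
weight of a word over `S` that represents `g`. -/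
noncomputable def weightNorm (S : Finset Γ) (ω : S → ℝ) (g : Γ) : ℝ :=
  sInf {r : ℝ | ∃ w : List S, (w.map Subtype.val).prod = g ∧ (w.map ω).sum = r}

/-- The growth function with respect to `ω`: the number of elements of norm at most `n`. -/
noncomputable def growth (S : Finset Γ) (ω : S → ℝ) (n : ℝ) : ℝ :=
  (Set.ncard {g : Γ | weightNorm S ω g ≤ n} : ℝ)

end Growth

/-- Domination of growth functions: `γ ≾ δ` if `γ n ≤ δ (C n)` for some constant `C > 0` and all
real `n ≥ 1`. -/
def Dominated (γ δ : ℝ → ℝ) : Prop :=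
  ∃ C : ℝ, 0 < C ∧ ∀ n : ℝ, 1 ≤ n → γ n ≤ δ (C * n)

open scoped Pointwise

/-! ### Pairs acting on the two subtrees, and generator relations -/

namespace Grigorchuk

/-! Let N(n) count the elements that are products of n factors `ca` or `da`. Any two such products
can be placed independently in the two coordinates of one longer product, at bounded cost. Three
such liftings change the alphabet {c,d} → {b,c} → {d,b} → {d,c}, squaring the count each time and
multiplying length by about 2, 4 and 4. The first is exact. In the other two, the part of a
coordinate that is not wanted stays in a finite dihedral group (`ac` and `ad` have finite order), so
only a constant factor is lost. This gives N(n)^8 ≤ 2^22 N(32n+5), hence growth at least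
exp(n^(3/5)), as log 8 / log 32 = 3/5. This covers 0.5157 and, exceeding 1/2, rules out exp(√n). -/

/-- The map underlying `pair g h`. -/
def pairFun (g h : Equiv.Perm (List Bool)) : List Bool → List Bool
  | [] => []
  | false :: σ => false :: g σ
  | true :: σ => true :: h σ

/-- The permutation fixing the empty sequence and acting as `g` below `0` and as `h` below `1`. -/
def pair (g h : Equiv.Perm (List Bool)) : Equiv.Perm (List Bool) where
  toFun := pairFun g h
  invFun := pairFun g⁻¹ h⁻¹
  left_inv := by rintro (_ | ⟨_ | _, σ⟩) <;> simp [pairFun]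
  right_inv := by rintro (_ | ⟨_ | _, σ⟩) <;> simp [pairFun]

@[simp] theorem pair_nil (g h : Equiv.Perm (List Bool)) : pair g h [] = [] := rfl

@[simp] theorem pair_false (g h : Equiv.Perm (List Bool)) (σ : List Bool) :
    pair g h (false :: σ) = false :: g σ := rfl

@[simp] theorem pair_true (g h : Equiv.Perm (List Bool)) (σ : List Bool) :
    pair g h (true :: σ) = true :: h σ := rfl

theorem pair_mul (g h g' h' : Equiv.Perm (List Bool)) :
    pair g h * pair g' h' = pair (g * g') (h * h') := by
  ext1 w
  rcases w with _ | ⟨_ | _, σ⟩ <;> simp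

theorem pair_one : pair 1 1 = 1 := by
  ext1 w
  rcases w with _ | ⟨_ | _, σ⟩ <;> simp

theorem pair_pow (g h : Equiv.Perm (List Bool)) (n : ℕ) : pair g h ^ n = pair (g ^ n) (h ^ n) := by
  induction n with
  | zero => simp [pair_one]
  | succ n ih => rw [pow_succ, ih, pair_mul, pow_succ, pow_succ]

theorem pair_inj {g h g' h' : Equiv.Perm (List Bool)} :
    pair g h = pair g' h' ↔ g = g' ∧ h = h' := by
  refine ⟨fun H => ⟨?_, ?_⟩, by rintro ⟨rfl, rfl⟩; rfl⟩
  · ext1 σ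
    simpa using DFunLike.congr_fun H (false :: σ)
  · ext1 σ
    simpa using DFunLike.congr_fun H (true :: σ)

theorem perm_apply (s : Gen) (w : List Bool) : perm s w = act s w := rfl

theorem perm_mul_self (s : Gen) : perm s * perm s = 1 := by
  ext1 w
  exact act_involutive s w

theorem perm_b : perm Gen.b = pair (perm Gen.a) (perm Gen.c) := by
  ext1 w
  rcases w with _ | ⟨_ | _, σ⟩ <;> simp [perm_apply, act]

theorem perm_c : perm Gen.c = pair (perm Gen.a) (perm Gen.d) := by
  ext1 w
  rcases w with _ | ⟨_ | _, σ⟩ <;> simp [perm_apply, act]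

theorem perm_d : perm Gen.d = pair 1 (perm Gen.b) := by
  ext1 w
  rcases w with _ | ⟨_ | _, σ⟩ <;> simp [perm_apply, act]

theorem perm_a_mul_pair (g h : Equiv.Perm (List Bool)) :
    perm Gen.a * pair g h = pair h g * perm Gen.a := by
  ext1 w
  rcases w with _ | ⟨_ | _, σ⟩ <;> simp [perm_apply, act]

theorem perm_a_conj_pair (g h : Equiv.Perm (List Bool)) :
    perm Gen.a * pair g h * perm Gen.a = pair h g := by
  rw [perm_a_mul_pair, mul_assoc, perm_mul_self, mul_one]

theorem a_mul_d_pow : (perm Gen.a * perm Gen.d) ^ 4 = 1 := by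
  have h : (perm Gen.a * perm Gen.d) ^ 2 = pair (perm Gen.b) (perm Gen.b) := by
    rw [pow_two, ← mul_assoc, perm_d, perm_a_conj_pair, pair_mul, one_mul, mul_one]
  rw [show 4 = 2 * 2 from rfl, pow_mul, h, pow_two, pair_mul, perm_mul_self, pair_one]

theorem a_mul_c_pow : (perm Gen.a * perm Gen.c) ^ 8 = 1 := by
  have h : (perm Gen.a * perm Gen.c) ^ 2 =
      pair (perm Gen.d * perm Gen.a) (perm Gen.a * perm Gen.d) := by
    rw [pow_two, ← mul_assoc, perm_c, perm_a_conj_pair, pair_mul]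
  have hinv : perm Gen.d * perm Gen.a = (perm Gen.a * perm Gen.d)⁻¹ := by
    rw [mul_inv_rev, inv_eq_of_mul_eq_one_left (perm_mul_self Gen.a),
      inv_eq_of_mul_eq_one_left (perm_mul_self Gen.d)]
  rw [show 8 = 2 * 4 from rfl, pow_mul, h, pair_pow, hinv, inv_pow, a_mul_d_pow, inv_one, pair_one]

/-! ### Alternating words -/

/-- The products `x₁ a x₂ a ⋯ xₙ a` with all `xᵢ` in `{x, y}`. -/
def alternating (x y : Gen) (n : ℕ) : Set (Equiv.Perm (List Bool)) :=
  {perm x * perm Gen.a, perm y * perm Gen.a} ^ n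

theorem alternating_finite (x y : Gen) (n : ℕ) : (alternating x y n).Finite := by
  induction n with
  | zero => rw [alternating, pow_zero]; exact Set.finite_one
  | succ n ih => rw [alternating, pow_succ]; exact ih.mul (Set.toFinite _)

theorem alternating_zero (x y : Gen) : alternating x y 0 = {1} := pow_zero _

theorem mem_alternating_succ {x y : Gen} {n : ℕ} {g : Equiv.Perm (List Bool)} :
    g ∈ alternating x y (n + 1) ↔ ∃ z, (z = x ∨ z = y) ∧ ∃ h ∈ alternating x y n,
      g = perm z * perm Gen.a * h := by
  rw [alternating, pow_succ', Set.mem_mul]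
  constructor
  · rintro ⟨k, rfl | rfl, h, hh, rfl⟩
    exacts [⟨x, .inl rfl, h, hh, rfl⟩, ⟨y, .inr rfl, h, hh, rfl⟩]
  · rintro ⟨z, rfl | rfl, h, hh, rfl⟩
    exacts [⟨_, .inl rfl, h, hh, rfl⟩, ⟨_, .inr rfl, h, hh, rfl⟩]

theorem mul_mem_alternating {x y : Gen} {m n : ℕ} {g h : Equiv.Perm (List Bool)}
    (hg : g ∈ alternating x y m) (hh : h ∈ alternating x y n) :
    g * h ∈ alternating x y (m + n) := by
  rw [alternating, pow_add]
  exact Set.mul_mem_mul hg hh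

theorem letter_mem_alternating {x y z : Gen} (hz : z = x ∨ z = y) :
    perm z * perm Gen.a ∈ alternating x y 1 :=
  mem_alternating_succ.2 ⟨z, hz, 1, by simp [alternating_zero], (mul_one _).symm⟩

/-! ### Lifting pairs of words and the recursive inequality -/

/-- If all pairs over `A` lift to `T` up to errors in `J`, then `T` is large. -/
theorem ncard_sq_le_of_lift {A J T : Set (Equiv.Perm (List Bool))} (hJ : J.Finite) (hT : T.Finite)
    (s s' t q : Equiv.Perm (List Bool))
    (H : ∀ u ∈ A, ∀ v ∈ A, ∃ j ∈ J, ∃ j' ∈ J, pair (j * s * v * s') (u * t * j') * q ∈ T) :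
    A.ncard ^ 2 ≤ J.ncard ^ 2 * T.ncard := by
  choose! j hj j' hj' hmem using H
  have key : (A ×ˢ A).ncard ≤ ((J ×ˢ J) ×ˢ T).ncard := by
    refine Set.ncard_le_ncard_of_injOn
      (fun p => ((j p.1 p.2, j' p.1 p.2), pair (j p.1 p.2 * s * p.2 * s')
        (p.1 * t * j' p.1 p.2) * q)) ?_ ?_ ((hJ.prod hJ).prod hT)
    · rintro ⟨u, v⟩ ⟨hu, hv⟩
      exact ⟨⟨hj u hu v hv, hj' u hu v hv⟩, hmem u hu v hv⟩
    -- Once both errors are known, cancellation recovers `u` and `v` from the lifted pair.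
    · rintro ⟨u, v⟩ - ⟨u', v'⟩ - h
      simp only [Prod.mk.injEq, mul_left_inj, pair_inj] at h
      obtain ⟨⟨h1, h2⟩, h3, h4⟩ := h
      rw [h1] at h3
      rw [h2] at h4
      simp only [mul_left_inj, mul_right_inj] at h3 h4
      rw [h3, h4]
  simpa only [Set.ncard_prod, pow_two] using key

/-- Both `b` and `c` have first coordinate `a`, so the letters spelling one word supply exactly the
separators `a` of the other: `y a y' a = (a z', z a)`. No error arises. -/
theorem pair_conj_mem_alternating (n : ℕ) {u v : Equiv.Perm (List Bool)}
    (hu : u ∈ alternating Gen.c Gen.d n) (hv : v ∈ alternating Gen.c Gen.d n) :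
    pair (perm Gen.a * v * perm Gen.a) u ∈ alternating Gen.b Gen.c (2 * n) := by
  have letter : ∀ z, (z = Gen.c ∨ z = Gen.d) →
      ∃ y, (y = Gen.b ∨ y = Gen.c) ∧ perm y = pair (perm Gen.a) (perm z) := by
    rintro z (rfl | rfl)
    exacts [⟨_, .inl rfl, perm_b⟩, ⟨_, .inr rfl, perm_c⟩]
  induction n generalizing u v with
  | zero =>
    rw [alternating_zero, Set.mem_singleton_iff] at hu hv
    rw [hu, hv, mul_one, perm_mul_self, pair_one, mul_zero, alternating_zero]
    rfl
  | succ n ih =>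
    obtain ⟨z, hz, u, hu', rfl⟩ := mem_alternating_succ.1 hu
    obtain ⟨z', hz', v, hv', rfl⟩ := mem_alternating_succ.1 hv
    obtain ⟨y, hy, ey⟩ := letter z hz
    obtain ⟨y', hy', ey'⟩ := letter z' hz'
    have h := mul_mem_alternating (mul_mem_alternating (letter_mem_alternating hy)
      (letter_mem_alternating hy')) (ih hu' hv')
    convert h using 1
    · congr 1; ring
    · rw [mul_assoc (perm y), ← mul_assoc (perm Gen.a) (perm y'), ey, ey', perm_a_conj_pair, pair_mul,
        pair_mul]
      simp only [mul_assoc]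

theorem sq_ncard_alternating_cd (n : ℕ) :
    (alternating Gen.c Gen.d n).ncard ^ 2 ≤ (alternating Gen.b Gen.c (2 * n)).ncard := by
  have h := ncard_sq_le_of_lift (A := alternating Gen.c Gen.d n) (Set.finite_singleton 1)
    (alternating_finite Gen.b Gen.c (2 * n)) (perm Gen.a) (perm Gen.a) 1 1
    fun u hu v hv => ⟨1, rfl, 1, rfl, by simpa using pair_conj_mem_alternating n hu hv⟩
  simpa using h

/-- The elements of the dihedral group generated by `a` and `y`. -/
def dihedral (y : Gen) : Set (Equiv.Perm (List Bool)) :=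
  (Subgroup.zpowers (perm Gen.a * perm y) : Set _) ∪
    (perm Gen.a * ·) '' (Subgroup.zpowers (perm Gen.a * perm y) : Set _)

theorem one_mem_dihedral (y : Gen) : 1 ∈ dihedral y := .inl (one_mem _)

theorem a_mul_mem_dihedral {y : Gen} {g : Equiv.Perm (List Bool)} (hg : g ∈ dihedral y) :
    perm Gen.a * g ∈ dihedral y := by
  rcases hg with hg | ⟨h, hh, rfl⟩
  · exact .inr ⟨g, hg, rfl⟩
  · refine .inl ?_
    simpa only [← mul_assoc, perm_mul_self, one_mul] using hh

theorem mul_mem_dihedral {y : Gen} {g : Equiv.Perm (List Bool)} (hg : g ∈ dihedral y) :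
    perm y * g ∈ dihedral y := by
  rcases hg with hg | ⟨h, hh, rfl⟩
  · refine .inr ⟨perm Gen.a * perm y * g, mul_mem (Subgroup.mem_zpowers _) hg, ?_⟩
    simp only [← mul_assoc, perm_mul_self, one_mul]
  · refine .inl ?_
    have : perm y * (perm Gen.a * h) = (perm Gen.a * perm y)⁻¹ * h := by
      rw [mul_inv_rev, inv_eq_of_mul_eq_one_left (perm_mul_self Gen.a),
        inv_eq_of_mul_eq_one_left (perm_mul_self y), mul_assoc]
    simp only [this]
    exact mul_mem (inv_mem (Subgroup.mem_zpowers _)) hh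

theorem dihedral_finite {y : Gen} {n : ℕ} (hn : 0 < n) (h : (perm Gen.a * perm y) ^ n = 1) :
    (dihedral y).Finite := by
  have : (Subgroup.zpowers (perm Gen.a * perm y) : Set (Equiv.Perm (List Bool))).Finite :=
    finite_zpowers.2 (isOfFinOrder_iff_pow_eq_one.2 ⟨n, hn, h⟩)
  exact this.union (this.image _)

theorem ncard_dihedral_le {y : Gen} {n : ℕ} (hn : 0 < n) (h : (perm Gen.a * perm y) ^ n = 1) :
    (dihedral y).ncard ≤ 2 * n := by
  have hfin : (Subgroup.zpowers (perm Gen.a * perm y) : Set (Equiv.Perm (List Bool))).Finite :=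
    finite_zpowers.2 (isOfFinOrder_iff_pow_eq_one.2 ⟨n, hn, h⟩)
  have hcard : (Subgroup.zpowers (perm Gen.a * perm y) : Set (Equiv.Perm (List Bool))).ncard ≤ n := by
    rw [← Nat.card_coe_set_eq]
    exact (Nat.card_zpowers _).trans_le (Nat.le_of_dvd hn (orderOf_dvd_of_pow_eq_one h))
  have h2 := Set.ncard_image_le (f := (perm Gen.a * ·)) hfin
  have h3 := Set.ncard_union_le
    (Subgroup.zpowers (perm Gen.a * perm y) : Set (Equiv.Perm (List Bool)))
    ((perm Gen.a * ·) '' (Subgroup.zpowers (perm Gen.a * perm y) : Set _))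
  unfold dihedral
  omega

/-- Odd places choose `d` or `y'` to spell `u` on the right; even places are always `y'`, giving the
separators. On the left only `1`, `a` and `y` appear, so the by-product is dihedral. -/
theorem exists_pair_mem_alternating {y y' : Gen} (hy : perm y' = pair (perm Gen.a) (perm y))
    (n : ℕ) {u : Equiv.Perm (List Bool)} (hu : u ∈ alternating Gen.b y n) :
    ∃ j ∈ dihedral y, pair j u ∈ alternating Gen.d y' (2 * n) := by
  have letter : ∀ z, (z = Gen.b ∨ z = y) → ∃ z', (z' = Gen.d ∨ z' = y') ∧
      ∃ t, (∀ j ∈ dihedral y, t * j ∈ dihedral y) ∧ perm z' = pair t (perm z) := by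
    rintro z (rfl | rfl)
    exacts [⟨_, .inl rfl, 1, by simp, perm_d⟩,
      ⟨_, .inr rfl, perm Gen.a, fun j => a_mul_mem_dihedral, hy⟩]
  induction n generalizing u with
  | zero =>
    rw [alternating_zero, Set.mem_singleton_iff] at hu
    exact ⟨1, one_mem_dihedral y, by simp [hu, pair_one, alternating_zero]⟩
  | succ n ih =>
    obtain ⟨z, hz, u, hu', rfl⟩ := mem_alternating_succ.1 hu
    obtain ⟨j, hj, hju⟩ := ih hu'
    obtain ⟨z', hz', t, ht, ez⟩ := letter z hz
    refine ⟨t * (perm y * j), ht _ (mul_mem_dihedral hj), ?_⟩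
    have h := mul_mem_alternating (mul_mem_alternating (letter_mem_alternating hz')
      (letter_mem_alternating (x := Gen.d) (.inr rfl : y' = Gen.d ∨ y' = y'))) hju
    convert h using 1
    · congr 1; ring
    · rw [mul_assoc (perm z'), ← mul_assoc (perm Gen.a), ez, hy, perm_a_conj_pair, pair_mul,
        pair_mul]
      simp only [mul_assoc]

theorem sq_ncard_alternating_b {y y' : Gen} (hy : perm y' = pair (perm Gen.a) (perm y))
    {m : ℕ} (hm : 0 < m) (h : (perm Gen.a * perm y) ^ m = 1) (n : ℕ) :
    (alternating Gen.b y n).ncard ^ 2 ≤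
      (2 * m) ^ 2 * (alternating Gen.d y' (4 * n + 1)).ncard := by
  -- The lift is `(j,u) · y'a · (j',v) = (j a v, u y j') a`: the middle `a` swaps the coordinates of
  -- the second half and adds 1 to the length.
  refine (ncard_sq_le_of_lift (dihedral_finite hm h) (alternating_finite Gen.d y' (4 * n + 1))
    (perm Gen.a) 1 (perm y) (perm Gen.a) fun u hu v hv => ?_).trans
    (Nat.mul_le_mul_right _ (Nat.pow_le_pow_left (ncard_dihedral_le hm h) 2))
  obtain ⟨j, hj, hju⟩ := exists_pair_mem_alternating hy n hu
  obtain ⟨j', hj', hjv⟩ := exists_pair_mem_alternating hy n hv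
  refine ⟨j, hj, j', hj', ?_⟩
  have h := mul_mem_alternating (mul_mem_alternating hju
    (letter_mem_alternating (x := Gen.d) (.inr rfl : y' = Gen.d ∨ y' = y'))) hjv
  convert h using 1
  · congr 1; ring
  · rw [mul_assoc (pair j u), mul_assoc (perm y'), perm_a_mul_pair, hy, ← mul_assoc, ← mul_assoc,
      pair_mul, pair_mul, mul_one]

theorem alternating_comm (x y : Gen) (n : ℕ) : alternating x y n = alternating y x n := by
  rw [alternating, alternating, Set.pair_comm]

theorem ncard_alternating_cd_pow_le (n : ℕ) :
    (alternating Gen.c Gen.d n).ncard ^ 8 ≤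
      2 ^ 22 * (alternating Gen.c Gen.d (32 * n + 5)).ncard := by
  have h1 := sq_ncard_alternating_cd n
  have h2 := sq_ncard_alternating_b perm_b (by norm_num) a_mul_c_pow (2 * n)
  have h3 := sq_ncard_alternating_b perm_c (by norm_num) a_mul_d_pow (4 * (2 * n) + 1)
  rw [alternating_comm Gen.d Gen.b] at h2
  rw [alternating_comm Gen.d Gen.c, show 4 * (4 * (2 * n) + 1) + 1 = 32 * n + 5 by ring] at h3
  calc (alternating Gen.c Gen.d n).ncard ^ 8
      = (((alternating Gen.c Gen.d n).ncard ^ 2) ^ 2) ^ 2 := by ring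
    _ ≤ ((alternating Gen.b Gen.c (2 * n)).ncard ^ 2) ^ 2 := by gcongr
    _ ≤ ((2 * 8) ^ 2 * (alternating Gen.b Gen.d (4 * (2 * n) + 1)).ncard) ^ 2 := by gcongr
    _ = (2 * 8) ^ 4 * (alternating Gen.b Gen.d (4 * (2 * n) + 1)).ncard ^ 2 := by ring
    _ ≤ (2 * 8) ^ 4 * ((2 * 4) ^ 2 * (alternating Gen.c Gen.d (32 * n + 5)).ncard) := by gcongr
    _ = _ := by ring

/-! ### Base case and iteration -/

/-- Images of a pair of sequences under all elements of `alternating c d n`. -/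
def orbitList (v : List Bool × List Bool) : ℕ → List (List Bool × List Bool)
  | 0 => [v]
  | n + 1 => (orbitList v n).flatMap fun w =>
      [(act Gen.c (act Gen.a w.1), act Gen.c (act Gen.a w.2)),
        (act Gen.d (act Gen.a w.1), act Gen.d (act Gen.a w.2))]

theorem exists_of_mem_orbitList {v w : List Bool × List Bool} {n : ℕ} (hw : w ∈ orbitList v n) :
    ∃ g ∈ alternating Gen.c Gen.d n, (g v.1, g v.2) = w := by
  induction n generalizing w with
  | zero =>
    rw [orbitList, List.mem_singleton] at hw
    exact ⟨1, by simp [alternating_zero], by simp [hw]⟩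
  | succ n ih =>
    rw [orbitList, List.mem_flatMap] at hw
    obtain ⟨w', hw', hw⟩ := hw
    obtain ⟨g, hg, rfl⟩ := ih hw'
    simp only [List.mem_cons, List.not_mem_nil, or_false] at hw
    rcases hw with rfl | rfl
    exacts [⟨_, mem_alternating_succ.2 ⟨Gen.c, .inl rfl, g, hg, rfl⟩, rfl⟩,
      ⟨_, mem_alternating_succ.2 ⟨Gen.d, .inr rfl, g, hg, rfl⟩, rfl⟩]

theorem card_orbitList_le (v : List Bool × List Bool) (n : ℕ) :
    (orbitList v n).toFinset.card ≤ (alternating Gen.c Gen.d n).ncard := by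
  rw [← Set.ncard_coe_finset]
  refine (Set.ncard_le_ncard ?_ ((alternating_finite _ _ _).image _)).trans
    (Set.ncard_image_le (f := fun g => (g v.1, g v.2)) (alternating_finite _ _ _))
  intro w hw
  exact exists_of_mem_orbitList (List.mem_toFinset.1 hw)

/-- Distinct images of one well-chosen pair of sequences certify distinct group elements, which
reduces the bound to a finite computation. -/
theorem le_ncard_alternating_six : 32 ≤ (alternating Gen.c Gen.d 6).ncard := by
  refine le_trans ?_ (card_orbitList_le
    ([false, true, true, false, true, true], [true, true, true, true, false, true]) 6)
  decide +kernel

/-- The `+ 4` absorbs the constant: 8·4 = 32 ≥ 22 + 4. The `n + 1` absorbs the shift: 32n + 6 ≤ 32(n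
+ 1). -/
theorem exists_le_ncard_alternating (k : ℕ) :
    ∃ n, n + 1 ≤ 7 * 32 ^ k ∧ 2 ^ (8 ^ k + 4) ≤ (alternating Gen.c Gen.d n).ncard := by
  induction k with
  | zero => exact ⟨6, by norm_num, le_ncard_alternating_six⟩
  | succ k ih =>
    obtain ⟨n, hn, hcard⟩ := ih
    refine ⟨32 * n + 5, by rw [pow_succ]; omega, ?_⟩
    have h := (Nat.pow_le_pow_left hcard 8).trans (ncard_alternating_cd_pow_le n)
    rw [← pow_mul, show (8 ^ k + 4) * 8 = 22 + (8 ^ (k + 1) + 10) by ring, pow_add] at h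
    refine le_trans (Nat.pow_le_pow_right (by norm_num) (by omega))
      (Nat.le_of_mul_le_mul_left h (by positivity))

theorem perm_mem (s : Gen) : perm s ∈ G := Subgroup.subset_closure ⟨s, rfl⟩

end Grigorchuk

/-! ### Weighted norms and growth functions -/

section Growth

theorem sum_weight_nonneg {ι : Type*} {ω : ι → ℝ} (hω : ∀ s, 0 < ω s) (w : List ι) : 0 ≤ (w.map ω).sum :=
  List.sum_nonneg fun x hx => by
    obtain ⟨s, -, rfl⟩ := List.mem_map.1 hx
    exact (hω s).le

theorem exists_pos_mul_length_le {ι : Type*} [Finite ι] {ω : ι → ℝ} (hω : ∀ s, 0 < ω s) :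
    ∃ ε : ℝ, 0 < ε ∧ ∀ w : List ι, ε * w.length ≤ (w.map ω).sum := by
  obtain ⟨ε, hε, h⟩ : ∃ ε : ℝ, 0 < ε ∧ ∀ s, ε ≤ ω s := by
    rcases isEmpty_or_nonempty ι with hι | hι
    · exact ⟨1, one_pos, fun s => hι.elim s⟩
    · obtain ⟨s, hs⟩ := Finite.exists_min ω
      exact ⟨ω s, hω s, hs⟩
  refine ⟨ε, hε, fun w => ?_⟩
  induction w with
  | nil => simp
  | cons s w ih =>
    simp only [List.length_cons, List.map_cons, List.sum_cons]
    push_cast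
    linarith [h s]

variable {Γ : Type*} [Group Γ] {S : Finset Γ} {ω : S → ℝ}

theorem weightNorm_le (hω : ∀ s, 0 < ω s) (w : List S) :
    weightNorm S ω (w.map Subtype.val).prod ≤ (w.map ω).sum :=
  csInf_le ⟨0, by rintro r ⟨w, -, rfl⟩; exact sum_weight_nonneg hω w⟩ ⟨w, rfl, rfl⟩

theorem exists_word (hS : Submonoid.closure (S : Set Γ) = ⊤) (g : Γ) :
    ∃ w : List S, (w.map Subtype.val).prod = g := by
  obtain ⟨l, hl, rfl⟩ := Submonoid.exists_list_of_mem_closure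
    (show g ∈ Submonoid.closure (S : Set Γ) by rw [hS]; trivial)
  lift l to List S using hl
  exact ⟨l, rfl⟩

theorem finite_weightNorm_le (hS : Submonoid.closure (S : Set Γ) = ⊤) (hω : ∀ s, 0 < ω s) (n : ℝ) :
    {g : Γ | weightNorm S ω g ≤ n}.Finite := by
  obtain ⟨ε, hε, hlen⟩ := exists_pos_mul_length_le hω
  refine ((List.finite_length_le S ⌊(n + 1) / ε⌋₊).image
    fun w => (w.map Subtype.val).prod).subset fun g hg => ?_
  obtain ⟨w, hw⟩ := exists_word hS g
  -- The slack 1 yields an actual word without showing that the infimum is attained.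
  have hlt : weightNorm S ω g < n + 1 := lt_of_le_of_lt hg (lt_add_one n)
  rw [weightNorm] at hlt
  obtain ⟨r, ⟨v, hv, rfl⟩, hr⟩ := exists_lt_of_csInf_lt
    (by exact ⟨_, w, hw, rfl⟩) hlt
  refine ⟨v, Nat.le_floor ?_, hv⟩
  rw [le_div_iff₀ hε]
  linarith [hlen v]

theorem growth_mono (hS : Submonoid.closure (S : Set Γ) = ⊤) (hω : ∀ s, 0 < ω s) :
    Monotone (growth S ω) := fun _ n h =>
  Nat.cast_le.2 (Set.ncard_le_ncard (fun _ hg => le_trans hg h) (finite_weightNorm_le hS hω n))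

end Growth

/-! ### From alternating words to growth -/

namespace Grigorchuk

variable {S : Finset G} {ω : S → ℝ}

theorem exists_weight_alternating (hS : Submonoid.closure (S : Set G) = ⊤) (x y : Gen) :
    ∃ K : ℝ, 0 < K ∧ ∀ n, ∀ g ∈ alternating x y n, ∃ w : List S,
      ((w.map Subtype.val).prod : G) = g ∧ (w.map ω).sum ≤ K * n := by
  choose word hword using exists_word hS
  let u (z : Gen) : List S := word (⟨perm z, perm_mem z⟩ * ⟨perm Gen.a, perm_mem Gen.a⟩)
  refine ⟨max 1 (max ((u x).map ω).sum ((u y).map ω).sum), by positivity, fun n => ?_⟩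
  induction n with
  | zero =>
    intro g hg
    rw [alternating_zero, Set.mem_singleton_iff] at hg
    exact ⟨[], by simp [hg], by simp⟩
  | succ n ih =>
    intro g hg
    obtain ⟨z, hz, h, hh, rfl⟩ := mem_alternating_succ.1 hg
    obtain ⟨w, hw, hsum⟩ := ih h hh
    refine ⟨u z ++ w, ?_, ?_⟩
    · rw [List.map_append, List.prod_append, hword, ← hw]
      rfl
    · have : ((u z).map ω).sum ≤ max 1 (max ((u x).map ω).sum ((u y).map ω).sum) := by
        rcases hz with rfl | rfl <;> simp
      rw [List.map_append, List.sum_append]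
      push_cast
      linarith

theorem exists_ncard_alternating_le_growth (hS : Submonoid.closure (S : Set G) = ⊤)
    (hω : ∀ s, 0 < ω s) (x y : Gen) :
    ∃ K : ℝ, 0 < K ∧ ∀ n : ℕ, ((alternating x y n).ncard : ℝ) ≤ growth S ω (K * n) := by
  obtain ⟨K, hK, h⟩ := exists_weight_alternating (ω := ω) hS x y
  refine ⟨K, hK, fun n => Nat.cast_le.2 ?_⟩
  have hfin := finite_weightNorm_le hS hω (K * n)
  refine (Set.ncard_le_ncard ?_ (hfin.image _)).trans (Set.ncard_image_le (f := Subtype.val) hfin)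
  intro g hg
  obtain ⟨w, rfl, hsum⟩ := h n g hg
  exact ⟨_, (weightNorm_le hω w).trans hsum, rfl⟩

theorem dominated_exp_growth (hS : Submonoid.closure (S : Set G) = ⊤) (hω : ∀ s, 0 < ω s)
    {α : ℝ} (hα : α ≤ 3 / 5) : Dominated (fun n => Real.exp (n ^ α)) (growth S ω) := by
  obtain ⟨K, hK, hgrowth⟩ := exists_ncard_alternating_le_growth hS hω Gen.c Gen.d
  refine ⟨K * (7 * 32 ^ 2), by positivity, fun n hn => ?_⟩
  obtain ⟨k, hk, hk'⟩ := exists_nat_pow_near hn (show (1 : ℝ) < 32 by norm_num)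
  -- `k + 1` covers n < 32^(k+1); one further level gains the factor 8 in the exponent that turns
  -- base 2 into base e.
  obtain ⟨m, hm, hcard⟩ := exists_le_ncard_alternating (k + 2)
  have h8 : n ^ α ≤ 8 ^ (k + 1) := by
    calc n ^ α ≤ n ^ (3 / 5 : ℝ) := Real.rpow_le_rpow_of_exponent_le hn hα
      _ ≤ ((32 : ℝ) ^ (k + 1)) ^ (3 / 5 : ℝ) :=
        Real.rpow_le_rpow (by linarith) hk'.le (by norm_num)
      _ = (((2 : ℝ) ^ (k + 1)) ^ (5 : ℝ)) ^ (3 / 5 : ℝ) := by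
        rw [show (32 : ℝ) = 2 ^ 5 by norm_num, ← pow_mul, mul_comm, pow_mul]
        norm_cast
      _ = 8 ^ (k + 1) := by
        rw [← Real.rpow_mul (by positivity), show (5 : ℝ) * (3 / 5) = (3 : ℕ) by norm_num,
          Real.rpow_natCast, ← pow_mul, mul_comm, pow_mul]
        norm_num
  have hexp : Real.exp (n ^ α) ≤ 2 ^ (8 ^ (k + 2) + 4) := by
    have h2 : Real.exp 1 ≤ 2 ^ 8 := by linarith [Real.exp_one_lt_d9]
    calc Real.exp (n ^ α) ≤ Real.exp ((8 ^ (k + 1) : ℕ) * 1) := by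
          rw [Real.exp_le_exp]; push_cast; linarith
      _ = Real.exp 1 ^ (8 ^ (k + 1)) := Real.exp_nat_mul _ _
      _ ≤ (2 ^ 8) ^ (8 ^ (k + 1)) := by gcongr
      _ = 2 ^ (8 ^ (k + 2)) := by rw [← pow_mul, ← pow_succ']
      _ ≤ 2 ^ (8 ^ (k + 2) + 4) := pow_le_pow_right₀ (by norm_num) (by omega)
  have hm' : K * m ≤ K * (7 * 32 ^ 2) * n := by
    have : (m : ℝ) + 1 ≤ 7 * 32 ^ (k + 2) := by exact_mod_cast hm
    rw [mul_assoc]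
    refine mul_le_mul_of_nonneg_left ?_ hK.le
    rw [pow_add] at this
    linarith
  calc Real.exp (n ^ α) ≤ 2 ^ (8 ^ (k + 2) + 4) := hexp
    _ ≤ ((alternating Gen.c Gen.d m).ncard : ℝ) := by exact_mod_cast hcard
    _ ≤ growth S ω (K * m) := hgrowth m
    _ ≤ _ := growth_mono hS hω hm'

end Grigorchuk

theorem not_dominated_exp_sqrt {γ : ℝ → ℝ} {α : ℝ} (hα : 1 / 2 < α)
    (h : Dominated (fun n => Real.exp (n ^ α)) γ) :
    ¬ Dominated γ (fun n => Real.exp (Real.sqrt n)) := by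
  rintro ⟨C', hC', h'⟩
  obtain ⟨C, hC, h⟩ := h
  have hlim : Filter.Tendsto (fun n : ℝ => n ^ (α - 1 / 2)) Filter.atTop Filter.atTop :=
    tendsto_rpow_atTop (by linarith)
  obtain ⟨n, hn, hn1, hnC⟩ := ((hlim.eventually_gt_atTop (Real.sqrt (C' * C))).and
    ((Filter.eventually_ge_atTop 1).and (Filter.eventually_ge_atTop (1 / C)))).exists
  -- n ≥ 1/C makes C n an admissible argument of the second domination.
  have hle := (h n hn1).trans (h' (C * n) (by rwa [div_le_iff₀' hC] at hnC))
  rw [Real.exp_le_exp, ← mul_assoc, Real.sqrt_mul (by positivity)] at hle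
  have hpos : 0 < n := by linarith
  have : n ^ α = n ^ (α - 1 / 2) * Real.sqrt n := by
    rw [Real.sqrt_eq_rpow, ← Real.rpow_add hpos, sub_add_cancel]
  rw [this] at hle
  exact absurd hle (not_le.2 (mul_lt_mul_of_pos_right hn (Real.sqrt_pos.2 hpos)))

theorem theorem1 (S : Finset Grigorchuk.G)
    (hS : Submonoid.closure (S : Set Grigorchuk.G) = ⊤)
    (ω : S → ℝ) (hω : ∀ s : S, 0 < ω s) :
    Dominated (fun n : ℝ => Real.exp (n ^ (0.5157 : ℝ))) (growth S ω) ∧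
      ¬ Dominated (growth S ω) (fun n : ℝ => Real.exp (Real.sqrt n)) := by
  have h := Grigorchuk.dominated_exp_growth hS hω (show (0.5157 : ℝ) ≤ 3 / 5 by norm_num)
  exact ⟨h, not_dominated_exp_sqrt (by norm_num) h⟩
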